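/- Let $1\le i\le n$ and let $W=S_{n+1}$ be generated by the simple transpositions $s_p=(p\;p{+}1)$, $1\le p\le n$ (products are composed as maps, and length is word length in the $s_p$). Let $W^i$ be the set of elements of minimal length in their left coset modulo $\mathrm{Stab}_W(\omega_i)=S_i\times S_{n+1-i}$, and let $w_0\in W^i$ be the minimal length representative of the coset of the longest element $a\mapsto n+2-a$ of $W$. For $w\in W^i$ and $1\le k\le i$ put $$\ell_k=\max\big(\{i-1\}\cup\{j\mid i\le j\le n,\ w(j+1)<w(k)\}\big),\qquad \underline{\ell}_w=(\ell_1,\dots,\ell_i).$$ Let $\mathcal P_{\underline\ell_w}$ be the poset with elements $x_{k,j}$, $1\le k\le i$, $i\le j\le \ell_k$, where $x_{k_1,j_1}\ge x_{k_2,j_2}$ if and only if $k_1\le k_2$ and $j_1\ge j_2$, and let $\mathcal O_{\underline\ell_w}=\{s\in[0,1]^{\mathcal P_{\underline\ell_w}}\mid s_a\ge s_b \text{ if } a>b\}$ be its order polytope. For an integer $m\ge 0$ the Gelfand-Tsetlin polytope $GT(m\omega_{n+1-i})$ is the set of real arrays $(s_{k,j})_{1\le k\le n,\,1\le j\le n+1-k}$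 with $s_{k-1,j}\ge s_{k,j}\ge s_{k-1,j+1}$ for all $1\le k\le n$, $1\le j\le n+1-k$, where $s_{0,j}=m$ for $j\le n+1-i$ and $s_{0,j}=0$ for $j>n+1-i$. A set $D$ of pairs $(k,j)$ with $k\ge0$, $j\ge1$, $k+j\le n$ defines the Kogan face $F_D(m)=\{s\in GT(m\omega_{n+1-i})\mid s_{k,j}=s_{k+1,j}\text{ for all }(k,j)\in D\}$. Its type is the product, from left to right, of the $s_{k+j}$, $(k,j)\in D$, read row by row from the bottom row $k=n-1$ to the top row $k=0$, and with $j$ increasing in each row; $D$ is called reduced if this product is a reduced decomposition. A Kogan face of type $\tau$ in $GT(m\omega_{n+1-i})$ is a set of the form $F_D(m)$ for some $D$ of type $\tau$. Then for every $w\in W^i$ there is a reduced set $D$ of type $ww_0^{-1}$, independent of $m$, such that for every integer $m\ge 0$: 1. $F_D(m)$ is the unique Kogan face of type $ww_0^{-1}$ in $GT(m\omega_{n+1-i})$ that is maximal with respect to inclusion, and every Kogan face of this type is contained in it; 2. $F_D(m)$ is unimodularly isomorphic to $m\,\mathcal O_{\underline\ell_w}$, that is, there is an affine isomorphism between the affine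 hulls of these two polytopes that maps the one polytope onto the other and maps the integral points of the one affine hull onto those of the other. -/

import Mathlib

open scoped Pointwise

noncomputable section

namespace KoganFaces

/-! ### The Weyl group of type `A_n`

The Weyl group is `Equiv.Perm (Fin (n + 1))`; the element `a` of `{1, …, n + 1}` is the
element `a - 1` of `Fin (n + 1)`. -/

/-- The simple reflection `s_p`, the transposition of `p` and `p + 1`, for `1 ≤ p ≤ n`
(the value for other `p` is irrelevant). -/
def simpleReflection (n p : ℕ) : Equiv.Perm (Fin (n + 1)) :=
  if h : 1 ≤ p ∧ p ≤ n then
    Equiv.swap ⟨p - 1, by omega⟩ ⟨p, by omega⟩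
  else 1

/-- The product `s_{p_1} s_{p_2} ⋯ s_{p_r}` of a word in the simple reflections. -/
def wordProd (n : ℕ) (u : List ℕ) : Equiv.Perm (Fin (n + 1)) :=
  (u.map (simpleReflection n)).prod

/-- The length of `w`: the least number of simple reflections with product `w`. -/
def length (n : ℕ) (w : Equiv.Perm (Fin (n + 1))) : ℕ :=
  sInf {r | ∃ u : List ℕ, (∀ p ∈ u, 1 ≤ p ∧ p ≤ n) ∧ wordProd n u = w ∧ u.length = r}

/-- The stabilizer of the fundamental weight `ω_i = ε_1 + ⋯ + ε_i`: the permutations that map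
`{1, …, i}` to itself. -/
def weightStabilizer (n i : ℕ) : Subgroup (Equiv.Perm (Fin (n + 1))) :=
  MulAction.stabilizer (Equiv.Perm (Fin (n + 1))) {a : Fin (n + 1) | a.val < i}

/-- `w ∈ W^i`: `w` has minimal length in its coset modulo the stabilizer of `ω_i`. -/
def IsMinCosetRep (n i : ℕ) (w : Equiv.Perm (Fin (n + 1))) : Prop :=
  ∀ u ∈ weightStabilizer n i, length n w ≤ length n (w * u)

/-- The element of minimal length in the coset of `v` modulo the stabilizer of `ω_i`. -/
def minCosetRep (n i : ℕ) (v : Equiv.Perm (Fin (n + 1))) : Equiv.Perm (Fin (n + 1)) :=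
  Function.argminOn (length n) {x | v⁻¹ * x ∈ weightStabilizer n i}
    ⟨v, by simp [one_mem]⟩

/-- The element `w_0`: the representative of minimal length of the coset of the longest element
`a ↦ n + 2 - a` of the Weyl group. -/
def wZero (n i : ℕ) : Equiv.Perm (Fin (n + 1)) :=
  minCosetRep n i Fin.revPerm

/-- For `1 ≤ k ≤ i`: `ℓ_k = max ({i - 1} ∪ {j | i ≤ j ≤ n, w (j + 1) < w k})`. The condition
`w (j + 1) < w k` says that `w` maps the positive root `α_{k,j} = ε_k - ε_{j+1}` to a negative
root. In the code `j : Fin (n + 1)` stands for the point `j + 1` and `c` for the point `k`. -/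
def ell (n i : ℕ) (w : Equiv.Perm (Fin (n + 1))) (k : ℕ) : ℕ :=
  max (i - 1) (sSup {j | ∃ a c : Fin (n + 1), a.val = j ∧ c.val + 1 = k ∧ i ≤ j ∧ w a < w c})

/-! ### The posets and their order polytopes -/

/-- The poset of all `x_{k,j}` with `1 ≤ k ≤ i` and `i ≤ j ≤ ℓ_k`. The order dual in the first
coordinate makes `x_{k₁,j₁} ≥ x_{k₂,j₂}` mean `k₁ ≤ k₂` and `j₁ ≥ j₂`. -/
abbrev EllPoset (i : ℕ) (l : ℕ → ℕ) : Type :=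
  {x : ℕᵒᵈ × ℕ // (1 ≤ OrderDual.ofDual x.1 ∧ OrderDual.ofDual x.1 ≤ i) ∧
    i ≤ x.2 ∧ x.2 ≤ l (OrderDual.ofDual x.1)}

/-- The order polytope of a poset. -/
def orderPolytope (P : Type) [PartialOrder P] : Set (P → ℝ) :=
  {s | (∀ a, 0 ≤ s a ∧ s a ≤ 1) ∧ ∀ a b, b < a → s b ≤ s a}

/-! ### Unimodular isomorphism -/

/-- The lattice of integral points. -/
def latticePoints (ι : Type) : Set (ι → ℝ) :=
  {x | ∀ a, ∃ z : ℤ, x a = z}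

/-- `P` and `Q` are unimodularly isomorphic: an affine isomorphism between their affine hulls
maps `P` onto `Q` and the lattice points of the affine hull of `P` onto those of the affine hull
of `Q`. -/
def UnimodularIso {ι κ : Type} (P : Set (ι → ℝ)) (Q : Set (κ → ℝ)) : Prop :=
  ∃ f : (ι → ℝ) →ᵃ[ℝ] (κ → ℝ),
    Set.InjOn f (affineSpan ℝ P : Set (ι → ℝ)) ∧
    f '' P = Q ∧
    f '' ((affineSpan ℝ P : Set (ι → ℝ)) ∩ latticePoints ι) =
      (affineSpan ℝ Q : Set (κ → ℝ)) ∩ latticePoints κ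

/-! ### Gelfand-Tsetlin polytopes and Kogan faces -/

/-- The index set of the coordinates `s_{k,j}`, `1 ≤ k ≤ n`, `1 ≤ j ≤ n + 1 - k`. -/
abbrev GTIndex (n : ℕ) : Type :=
  {p : ℕ × ℕ // 1 ≤ p.1 ∧ 1 ≤ p.2 ∧ p.1 + p.2 ≤ n + 1}

/-- The top row of the Gelfand-Tsetlin patterns for `λ = ∑ c_a ω_a`:
`s_{0,j} = c_j + ⋯ + c_n`. -/
def topRow (n : ℕ) (c : ℕ → ℕ) (j : ℕ) : ℝ :=
  ∑ a ∈ Finset.Icc j n, (c a : ℝ)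

/-- The entry `s_{k,j}` of the triangular array with top row fixed by `λ = ∑ c_a ω_a`. -/
def entry (n : ℕ) (c : ℕ → ℕ) (s : GTIndex n → ℝ) (k j : ℕ) : ℝ :=
  if k = 0 then topRow n c j
  else if h : 1 ≤ k ∧ 1 ≤ j ∧ k + j ≤ n + 1 then s ⟨(k, j), h⟩ else 0

/-- The Gelfand-Tsetlin polytope `GT(λ)`, `λ = ∑ c_a ω_a`. -/
def gtPolytope (n : ℕ) (c : ℕ → ℕ) : Set (GTIndex n → ℝ) :=
  {s | ∀ k j : ℕ, 1 ≤ k → 1 ≤ j → k + j ≤ n + 1 →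
    entry n c s k j ≤ entry n c s (k - 1) j ∧ entry n c s (k - 1) (j + 1) ≤ entry n c s k j}

/-- The index set of the equalities `A_{k,j} : x_{k,j} = x_{k+1,j}`. -/
def koganIndex (n : ℕ) : Set (ℕ × ℕ) :=
  {p | 1 ≤ p.2 ∧ p.1 + p.2 ≤ n}

/-- The face of `GT(λ)` defined by the equalities `A_{k,j}`, `(k, j) ∈ D`. -/
def koganFace (n : ℕ) (c : ℕ → ℕ) (D : Finset (ℕ × ℕ)) : Set (GTIndex n → ℝ) :=
  {s | s ∈ gtPolytope n c ∧ ∀ p ∈ D, entry n c s p.1 p.2 = entry n c s (p.1 + 1) p.2}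

/-- The word of a set `D` of equalities: run through the rows `k = n - 1, …, 1, 0` from the bottom
to the top, each row from left to right, and write `k + j` for every `A_{k,j}` in `D`. -/
def koganWord (n : ℕ) (D : Finset (ℕ × ℕ)) : List ℕ :=
  (List.range n).reverse.flatMap fun k =>
    ((List.range' 1 (n - k)).filter fun j => (k, j) ∈ D).map fun j => k + j

/-- The type of the face defined by `D`: the product of the `s_{k+j}` in the above order. -/
def koganType (n : ℕ) (D : Finset (ℕ × ℕ)) : Equiv.Perm (Fin (n + 1)) :=
  wordProd n (koganWord n D)

/-- `D` is reduced: its word is a reduced decomposition of its type. -/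
def IsReducedKogan (n : ℕ) (D : Finset (ℕ × ℕ)) : Prop :=
  (koganWord n D).length = length n (koganType n D)

/-- `F` is a Kogan face of type `τ` of `GT(λ)`. -/
def IsKoganFace (n : ℕ) (c : ℕ → ℕ) (τ : Equiv.Perm (Fin (n + 1)))
    (F : Set (GTIndex n → ℝ)) : Prop :=
  ∃ D : Finset (ℕ × ℕ), (D : Set (ℕ × ℕ)) ⊆ koganIndex n ∧ koganType n D = τ ∧
    F = koganFace n c D

end KoganFaces

end

open scoped Pointwise

noncomputable section

namespace KoganFaces

/-! ### The action of words in simple reflections -/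

/-! Points are counted from 0; put d = n + 1 - i and τ = w w₀⁻¹. Since w₀ maps the last d points
increasingly onto the first d, τ lists the values of w on its second block first, and it is
increasing on the first d and on the last i points (`mul_wZero_inv_isBlockMono`).

The set D is left-justified: row k consists of its first c_k places, where c_k counts the values
greater than k that stand to the left of k in τ. Row k is then a cycle that brings the value k to
its place, so the type is τ (`koganType_codeSet`). The c_k add up to at most the number of
inversions, a lower bound for the length, so the word is reduced.

For any set of type τ, reduced or not, follow a point b < d through the rows from top to bottom. It
can move up only along an equality of the set, and when it does not, interlacing takes over; in both
cases the pattern has the value m along the trajectory (`entry_upperProd`). Counting trajectories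
gives s_{τ(d-j),j} = m for 1 ≤ j ≤ d (`entry_eq_of_koganType`). These conditions depend only on τ
and cut out exactly the face of D (`mem_koganFace_codeSet_iff`), which therefore contains every face
of type τ.

On this face the entries with j > d are 0 and those with j ≤ d, k ≤ τ(d-j) are m. The others
correspond to the poset elements (`le_ell_iff`), and interlacing turns into the order relations and
the bounds 0 and m (`mem_koganFace_iff_comp_gtCoord`). Forgetting integral constants is unimodular.
-/

theorem simpleReflection_val {n p : ℕ} (hp : 1 ≤ p) (hpn : p ≤ n) (a : Fin (n + 1)) :
    (simpleReflection n p a).val =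
      if a.val = p - 1 then p else if a.val = p then p - 1 else a.val := by
  simp only [simpleReflection, hp, hpn, and_self, dite_true, Equiv.swap_apply_def, Fin.ext_iff]
  split_ifs <;> rfl

theorem wordProd_append (n : ℕ) (u v : List ℕ) :
    wordProd n (u ++ v) = wordProd n u * wordProd n v := by
  simp [wordProd]

theorem wordProd_cons (n p : ℕ) (u : List ℕ) :
    wordProd n (p :: u) = simpleReflection n p * wordProd n u := by
  simp [wordProd]

/-- An increasing word moves a point up by at most one. -/
theorem wordProd_sorted_apply {n : ℕ} (u : List ℕ) (hu : ∀ p ∈ u, 1 ≤ p ∧ p ≤ n)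
    (hs : u.Pairwise (· < ·)) (a : Fin (n + 1)) :
    ((wordProd n u a).val = a.val + 1 ∧ a.val + 1 ∈ u) ∨ (wordProd n u a).val ≤ a.val := by
  induction u with
  | nil => right; simp [wordProd]
  | cons p u ih =>
    rw [List.pairwise_cons] at hs
    have hp := hu p (by simp)
    rw [wordProd_cons, Equiv.Perm.mul_apply, simpleReflection_val hp.1 hp.2]
    -- The smallest letter `p` acts last. It cannot undo a move up to `a + 1`, because then `p < a +
    -- 1`; it can itself cause one only if `p = a + 1`.
    rcases ih (fun q hq => hu q (by simp [hq])) hs.2 with ⟨h1, h2⟩ | h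
    · have := hs.1 _ h2
      left
      refine ⟨?_, by simp [h2]⟩
      split_ifs <;> omega
    · by_cases hpa : p = a.val + 1
      · subst hpa
        split_ifs with h3 h4
        · left; simp
        · right; omega
        · right; omega
      · right; split_ifs <;> omega

/-- A point below all letters of a word is fixed. -/
theorem wordProd_apply_of_lt {n : ℕ} (u : List ℕ) (hu : ∀ p ∈ u, 1 ≤ p ∧ p ≤ n)
    (a : Fin (n + 1)) (ha : ∀ p ∈ u, a.val + 1 < p) : wordProd n u a = a := by
  induction u with
  | nil => simp [wordProd]
  | cons p u ih =>
    have hp := hu p (by simp)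
    have := ha p (by simp)
    rw [wordProd_cons, Equiv.Perm.mul_apply, ih (fun q hq => hu q (by simp [hq]))
      (fun q hq => ha q (by simp [hq]))]
    ext
    rw [simpleReflection_val hp.1 hp.2]
    split_ifs <;> omega

/-- The action of the cycle `s_{k+1} ⋯ s_{k+r}`. -/
theorem wordProd_range'_apply {n k : ℕ} (r : ℕ) (hr : k + r ≤ n) (a : Fin (n + 1)) :
    (wordProd n (List.range' (k + 1) r) a).val =
      if a.val = k + r then k else if k ≤ a.val ∧ a.val < k + r then a.val + 1 else a.val := by
  induction r generalizing a with
  | zero => 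
    simp only [List.range'_zero, wordProd, List.map_nil, List.prod_nil, Equiv.Perm.one_apply]
    split_ifs <;> omega
  | succ r ih =>
    rw [List.range'_concat, wordProd_append, Equiv.Perm.mul_apply, ih (by omega)]
    have h : wordProd n [k + 1 + 1 * r] = simpleReflection n (k + 1 + r) := by simp [wordProd]
    rw [h, simpleReflection_val (by omega) (by omega)]
    split_ifs <;> omega

/-! ### Inversions and length -/

/-- The inversions of a permutation. -/
def inversions {n : ℕ} (w : Equiv.Perm (Fin (n + 1))) : Finset (Fin (n + 1) × Fin (n + 1)) :=
  Finset.univ.filter fun x => x.1 < x.2 ∧ w x.2 < w x.1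

theorem mem_inversions {n : ℕ} (w : Equiv.Perm (Fin (n + 1))) (a b : Fin (n + 1)) :
    (a, b) ∈ inversions w ↔ a < b ∧ w b < w a := by
  simp [inversions]

/-- Only the order of the values `p - 1` and `p` is changed, so the pair of their preimages is the
only possible new inversion. -/
theorem card_inversions_simpleReflection_mul_le {n p : ℕ} (hp : 1 ≤ p) (hpn : p ≤ n)
    (w : Equiv.Perm (Fin (n + 1))) :
    (inversions (simpleReflection n p * w)).card ≤ (inversions w).card + 1 := by
  refine (Finset.card_le_card (t := insert
    (w⁻¹ ⟨p - 1, by omega⟩, w⁻¹ ⟨p, by omega⟩) (inversions w)) ?_).trans (Finset.card_insert_le _ _)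
  rintro ⟨a, b⟩ h
  simp only [inversions, Finset.mem_filter, Finset.mem_univ, true_and, Finset.mem_insert,
    Prod.mk.injEq, Equiv.Perm.mul_apply, Fin.lt_def, simpleReflection_val hp hpn,
    Equiv.Perm.eq_inv_iff_eq, Fin.ext_iff] at h ⊢
  have hab : (w a).val ≠ (w b).val := by
    intro h'
    have := w.injective (Fin.ext h')
    subst this
    omega
  obtain ⟨h1, h2⟩ := h
  split_ifs at h2 <;> omega

theorem card_inversions_wordProd_le {n : ℕ} (u : List ℕ) (hu : ∀ p ∈ u, 1 ≤ p ∧ p ≤ n) :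
    (inversions (wordProd n u)).card ≤ u.length := by
  induction u with
  | nil =>
    simp only [inversions, wordProd, List.map_nil, List.prod_nil, Equiv.Perm.one_apply,
      List.length_nil, nonpos_iff_eq_zero, Finset.card_eq_zero, Finset.filter_eq_empty_iff]
    rintro ⟨a, b⟩ - ⟨h1, h2⟩
    exact lt_asymm h1 h2
  | cons p u ih =>
    have hp := hu p (by simp)
    rw [wordProd_cons, List.length_cons]
    exact (card_inversions_simpleReflection_mul_le hp.1 hp.2 _).trans
      (Nat.succ_le_succ (ih fun q hq => hu q (by simp [hq])))

/-- Applying the reflection to both points of a pair embeds the inversions of the product into those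
of `w`, and misses the descent itself. -/
theorem card_inversions_mul_simpleReflection_lt {n p : ℕ} (hp : 1 ≤ p) (hpn : p ≤ n)
    (w : Equiv.Perm (Fin (n + 1)))
    (hw : w ⟨p, by omega⟩ < w ⟨p - 1, by omega⟩) :
    (inversions (w * simpleReflection n p)).card < (inversions w).card := by
  have hmem : ((⟨p - 1, by omega⟩, ⟨p, by omega⟩) : Fin (n + 1) × Fin (n + 1)) ∈ inversions w := by
    rw [mem_inversions, Fin.lt_def]
    exact ⟨by simp only; omega, hw⟩
  rw [← Finset.card_erase_add_one hmem, Nat.lt_succ_iff]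
  refine Finset.card_le_card_of_injOn
    (fun x => (simpleReflection n p x.1, simpleReflection n p x.2)) ?_ ?_
  · rintro ⟨a, b⟩ h
    rw [Finset.mem_coe] at h ⊢
    rw [mem_inversions] at h
    simp only [mem_inversions, Equiv.Perm.mul_apply, Finset.mem_erase, ne_eq,
      Prod.mk.injEq] at h ⊢
    obtain ⟨h1, h2⟩ := h
    have key : ¬ (a.val = p - 1 ∧ b.val = p) := by
      rintro ⟨ha, hb⟩
      have e1 : simpleReflection n p a = ⟨p, by omega⟩ := by
        ext; rw [simpleReflection_val hp hpn]; simp [ha]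
      have e2 : simpleReflection n p b = ⟨p - 1, by omega⟩ := by
        ext; rw [simpleReflection_val hp hpn]; simp only [hb]; split_ifs <;> omega
      rw [e1, e2] at h2
      exact lt_asymm hw h2
    refine ⟨?_, ?_, h2⟩
    rotate_left
    · rw [Fin.lt_def] at h1 ⊢
      rw [simpleReflection_val hp hpn, simpleReflection_val hp hpn]
      split_ifs <;> omega
    · rw [Fin.lt_def] at h1
      rw [Fin.ext_iff, Fin.ext_iff, simpleReflection_val hp hpn, simpleReflection_val hp hpn]
      simp only
      split_ifs <;> omega
  · rintro ⟨a, b⟩ - ⟨c, d⟩ - h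
    simpa using h

/-! ### The Lehmer code -/

/-- The number of points before `w⁻¹ k` with image greater than `k`. -/
def code {n : ℕ} (w : Equiv.Perm (Fin (n + 1))) (k : ℕ) : ℕ :=
  (Finset.univ.filter fun b : Fin (n + 1) => k < (w b).val ∧ ∃ a, (w a).val = k ∧ b < a).card

theorem code_le {n : ℕ} (w : Equiv.Perm (Fin (n + 1))) (k : ℕ) : code w k ≤ n - k := by
  rw [← Nat.card_Ioc k n]
  refine Finset.card_le_card_of_injOn (fun b => (w b).val) ?_ ?_
  · intro b hb
    simp only [Finset.coe_filter, Finset.mem_univ, true_and, Set.mem_ofPred_eq,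
      Finset.coe_Ioc, Set.mem_Ioc] at hb ⊢
    omega
  · intro a _ b _ h
    exact w.injective (Fin.ext h)

/-- The set of equalities whose `k`-th row consists of the first `code w k` places. -/
def codeSet {n : ℕ} (w : Equiv.Perm (Fin (n + 1))) : Finset (ℕ × ℕ) :=
  (Finset.range (n + 1) ×ˢ Finset.Icc 1 n).filter fun p => p.2 ≤ code w p.1

theorem mem_codeSet {n : ℕ} (w : Equiv.Perm (Fin (n + 1))) (k j : ℕ) :
    (k, j) ∈ codeSet w ↔ 1 ≤ j ∧ j ≤ code w k := by
  have := code_le w k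
  simp only [codeSet, Finset.mem_filter, Finset.mem_product, Finset.mem_range, Finset.mem_Icc]
  omega

theorem codeSet_subset {n : ℕ} (w : Equiv.Perm (Fin (n + 1))) :
    (codeSet w : Set (ℕ × ℕ)) ⊆ koganIndex n := by
  rintro ⟨k, j⟩ h
  rw [Finset.mem_coe, mem_codeSet] at h
  have := code_le w k
  simp only [koganIndex, Set.mem_ofPred_eq]
  omega

/-! ### Words of Kogan sets, row by row -/

/-- The letters of the row `k` of `D`. -/
def koganRow (n : ℕ) (D : Finset (ℕ × ℕ)) (k : ℕ) : List ℕ :=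
  ((List.range' 1 (n - k)).filter fun j => (k, j) ∈ D).map fun j => k + j

theorem mem_koganRow {n : ℕ} {D : Finset (ℕ × ℕ)} {k p : ℕ} :
    p ∈ koganRow n D k ↔ k + 1 ≤ p ∧ p ≤ n ∧ (k, p - k) ∈ D := by
  simp only [koganRow, List.mem_map, List.mem_filter, List.mem_range', decide_eq_true_eq]
  constructor
  · rintro ⟨j, ⟨⟨i, hi, rfl⟩, h⟩, rfl⟩
    refine ⟨by omega, by omega, ?_⟩
    rwa [Nat.add_sub_cancel_left]
  · rintro ⟨h1, h2, h3⟩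
    exact ⟨p - k, ⟨⟨p - k - 1, by omega, by omega⟩, h3⟩, by omega⟩

theorem koganRow_pairwise (n : ℕ) (D : Finset (ℕ × ℕ)) (k : ℕ) :
    (koganRow n D k).Pairwise (· < ·) := by
  unfold koganRow
  rw [List.pairwise_map]
  refine List.Pairwise.imp (fun h => by omega) (List.Pairwise.filter _ List.pairwise_lt_range')

theorem koganRow_codeSet {n : ℕ} (w : Equiv.Perm (Fin (n + 1))) (k : ℕ) :
    koganRow n (codeSet w) k = List.range' (k + 1) (code w k) := by
  have := code_le w k
  refine (koganRow_pairwise n _ k).eq_of_mem_iff List.pairwise_lt_range' fun p => ?_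
  rw [mem_koganRow, mem_codeSet, List.mem_range'_1]
  omega

/-- The product of the rows `k - 1, …, 0`. -/
def upperProd (n : ℕ) (D : Finset (ℕ × ℕ)) : ℕ → Equiv.Perm (Fin (n + 1))
  | 0 => 1
  | k + 1 => wordProd n (koganRow n D k) * upperProd n D k

theorem koganType_eq_upperProd (n : ℕ) (D : Finset (ℕ × ℕ)) :
    koganType n D = upperProd n D n := by
  have h : ∀ k, wordProd n ((List.range k).reverse.flatMap (koganRow n D)) = upperProd n D k := by
    intro k
    induction k with
    | zero => simp [wordProd, upperProd]
    | succ k ih =>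
      rw [List.range_succ, List.reverse_append, List.reverse_singleton, List.singleton_append,
        List.flatMap_cons, wordProd_append, ih, upperProd]
  exact h n

/-- Invariant of the sorting process: after the rows above `k`, the values below `k` are in place
and all other points fill the positions from `k` on in their original order. The point with value
`k` is then at position `k + code w k`, and the cycle of row `k` brings it down to `k`, shifting
those before it up by one. -/
theorem upperProd_codeSet_apply {n : ℕ} (w : Equiv.Perm (Fin (n + 1))) {k : ℕ} (hk : k ≤ n)
    (b : Fin (n + 1)) :
    (upperProd n (codeSet w) k b).val = if (w b).val < k then (w b).val else
      k + (Finset.univ.filter fun a : Fin (n + 1) => a < b ∧ k ≤ (w a).val).card := by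
  induction k with
  | zero =>
    simp [upperProd, Finset.filter_gt_eq_Iio]
  | succ k ih =>
    have hcode := code_le w k
    have ihb := ih (by omega)
    rw [upperProd, Equiv.Perm.mul_apply, koganRow_codeSet, wordProd_range'_apply _ (by omega)]
    obtain ⟨a, ha⟩ : ∃ a, (w a).val = k := ⟨w⁻¹ ⟨k, by omega⟩, by simp⟩
    have hcode' : code w k =
        (Finset.univ.filter fun c : Fin (n + 1) => c < a ∧ k ≤ (w c).val).card := by
      unfold code
      congr 1
      ext c
      simp only [Finset.mem_filter, Finset.mem_univ, true_and]
      constructor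
      · rintro ⟨h1, a', h2, h3⟩
        have : a' = a := w.injective (Fin.ext (h2.trans ha.symm))
        exact ⟨this ▸ h3, h1.le⟩
      · rintro ⟨h1, h2⟩
        refine ⟨lt_of_le_of_ne h2 fun h => ?_, a, ha, h1⟩
        exact h1.ne (w.injective (Fin.ext (h.symm.trans ha.symm)))
    rcases lt_trichotomy (w b).val k with h | h | h
    · rw [if_pos h] at ihb
      rw [if_pos (show (w b).val < k + 1 by omega)]
      split_ifs <;> omega
    · have : b = a := w.injective (Fin.ext (h.trans ha.symm))
      subst this
      rw [if_neg (by omega), ← hcode'] at ihb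
      rw [if_pos ihb, if_pos (by omega), h]
    · rw [if_neg (by omega)] at ihb
      rw [if_neg (show ¬ (w b).val < k + 1 by omega)]
      rcases lt_trichotomy b a with hab | hab | hab
      · have h1 : (Finset.univ.filter fun c : Fin (n + 1) => c < b ∧ k + 1 ≤ (w c).val) =
            (Finset.univ.filter fun c : Fin (n + 1) => c < b ∧ k ≤ (w c).val) := by
          ext c
          simp only [Finset.mem_filter, Finset.mem_univ, true_and]
          refine ⟨fun h => ⟨h.1, by omega⟩, fun h => ⟨h.1, lt_of_le_of_ne h.2 fun e => ?_⟩⟩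
          exact (h.1.trans hab).ne (w.injective (Fin.ext (e.symm.trans ha.symm)))
        have h2 : (Finset.univ.filter fun c : Fin (n + 1) => c < b ∧ k ≤ (w c).val).card <
            code w k := by
          rw [hcode']
          apply Finset.card_lt_card
          rw [Finset.ssubset_iff_of_subset]
          · exact ⟨b, by simp [hab, h.le], by simp⟩
          · intro c
            simp only [Finset.mem_filter, Finset.mem_univ, true_and]
            exact fun h => ⟨h.1.trans hab, h.2⟩
        rw [h1]
        split_ifs <;> omega
      · subst hab; omega
      · have h1 : (Finset.univ.filter fun c : Fin (n + 1) => c < b ∧ k ≤ (w c).val) =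
            insert a (Finset.univ.filter fun c : Fin (n + 1) => c < b ∧ k + 1 ≤ (w c).val) := by
          ext c
          simp only [Finset.mem_filter, Finset.mem_univ, true_and, Finset.mem_insert]
          constructor
          · rintro ⟨h1, h2⟩
            rcases h2.eq_or_lt with e | e
            · exact Or.inl (w.injective (Fin.ext (e.symm.trans ha.symm)))
            · exact Or.inr ⟨h1, e⟩
          · rintro (rfl | ⟨h1, h2⟩)
            · exact ⟨hab, ha.ge⟩
            · exact ⟨h1, by omega⟩
        have h2 : (Finset.univ.filter fun c : Fin (n + 1) => c < b ∧ k ≤ (w c).val).card =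
            (Finset.univ.filter fun c : Fin (n + 1) => c < b ∧ k + 1 ≤ (w c).val).card + 1 := by
          rw [h1, Finset.card_insert_of_notMem]
          simp [ha]
        have h3 : code w k ≤
            (Finset.univ.filter fun c : Fin (n + 1) => c < b ∧ k + 1 ≤ (w c).val).card := by
          unfold code
          apply Finset.card_le_card
          intro c
          simp only [Finset.mem_filter, Finset.mem_univ, true_and]
          rintro ⟨h4, a', h5, h6⟩
          have : a' = a := w.injective (Fin.ext (h5.trans ha.symm))
          exact ⟨(this ▸ h6).trans hab, h4⟩
        split_ifs <;> omega

theorem koganType_codeSet {n : ℕ} (w : Equiv.Perm (Fin (n + 1))) :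
    koganType n (codeSet w) = w := by
  rw [koganType_eq_upperProd]
  refine Equiv.ext fun b => Fin.ext ?_
  have h := upperProd_codeSet_apply w le_rfl b
  have h1 := (upperProd n (codeSet w) n b).isLt
  have h2 := (w b).isLt
  split_ifs at h <;> omega

theorem length_koganWord_codeSet_le {n : ℕ} (w : Equiv.Perm (Fin (n + 1))) :
    (koganWord n (codeSet w)).length ≤ (inversions w).card := by
  have h : (koganWord n (codeSet w)).length = ∑ k ∈ Finset.range n, code w k := by
    change ((List.range n).reverse.flatMap (koganRow n (codeSet w))).length = _
    have : ∀ k, ((List.range k).reverse.flatMap (koganRow n (codeSet w))).length =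
        ∑ j ∈ Finset.range k, code w j := by
      intro k
      induction k with
      | zero => simp
      | succ k ih =>
        rw [List.range_succ, List.reverse_append, List.reverse_singleton, List.singleton_append,
          List.flatMap_cons, List.length_append, ih, koganRow_codeSet, List.length_range',
          Finset.sum_range_succ, add_comm]
    exact this n
  rw [h]
  unfold code
  rw [← Finset.card_sigma]
  -- A point counted by `code w k` forms an inversion with the preimage of `k`. The default `0` is
  -- never reached, since `k < n`.
  refine Finset.card_le_card_of_injOn
    (fun x => (x.2, if hx : x.1 < n + 1 then w⁻¹ ⟨x.1, hx⟩ else 0)) ?_ ?_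
  · rintro ⟨k, b⟩ hx
    simp only [Finset.mem_coe, Finset.mem_sigma, Finset.mem_range, Finset.mem_filter,
      Finset.mem_univ, true_and] at hx
    obtain ⟨h1, h2, a, h3, h4⟩ := hx
    have ha : w⁻¹ ⟨k, by omega⟩ = a := by
      rw [Equiv.Perm.inv_eq_iff_eq]
      exact Fin.ext h3.symm
    simp only [inversions, Finset.mem_coe, Finset.mem_filter, Finset.mem_univ, true_and,
      dif_pos (show k < n + 1 by omega), ha]
    exact ⟨h4, by rw [Fin.lt_def]; omega⟩
  · rintro ⟨k, b⟩ hx ⟨k', b'⟩ hx' he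
    simp only [Finset.mem_coe, Finset.mem_sigma, Finset.mem_range] at hx hx'
    simp only [Prod.mk.injEq, dif_pos (show k < n + 1 by omega),
      dif_pos (show k' < n + 1 by omega), EmbeddingLike.apply_eq_iff_eq, Fin.mk.injEq] at he
    obtain ⟨rfl, rfl⟩ := he
    rfl

theorem koganWord_mem {n : ℕ} {D : Finset (ℕ × ℕ)} {p : ℕ} (hp : p ∈ koganWord n D) :
    1 ≤ p ∧ p ≤ n := by
  change p ∈ (List.range n).reverse.flatMap (koganRow n D) at hp
  rw [List.mem_flatMap] at hp
  obtain ⟨k, -, h⟩ := hp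
  rw [mem_koganRow] at h
  omega

theorem card_inversions_le_length {n : ℕ} (w : Equiv.Perm (Fin (n + 1))) :
    (inversions w).card ≤ length n w := by
  unfold length
  -- The infimum runs over a nonempty set because the word of `codeSet w` represents `w`.
  refine le_csInf ⟨_, koganWord n (codeSet w), fun p => koganWord_mem, koganType_codeSet w, rfl⟩ ?_
  rintro r ⟨u, hu, rfl, rfl⟩
  exact card_inversions_wordProd_le u hu

theorem length_le_length_koganWord {n : ℕ} (w : Equiv.Perm (Fin (n + 1))) :
    length n w ≤ (koganWord n (codeSet w)).length :=
  Nat.sInf_le ⟨koganWord n (codeSet w), fun _ => koganWord_mem, koganType_codeSet w, rfl⟩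

theorem length_eq_card_inversions {n : ℕ} (w : Equiv.Perm (Fin (n + 1))) :
    length n w = (inversions w).card :=
  ((length_le_length_koganWord w).trans (length_koganWord_codeSet_le w)).antisymm
    (card_inversions_le_length w)

theorem isReducedKogan_codeSet {n : ℕ} (w : Equiv.Perm (Fin (n + 1))) :
    IsReducedKogan n (codeSet w) := by
  unfold IsReducedKogan
  rw [koganType_codeSet]
  exact ((length_koganWord_codeSet_le w).trans (card_inversions_le_length w)).antisymm
    (length_le_length_koganWord w)

/-! ### Minimal coset representatives -/

theorem mem_weightStabilizer {n i : ℕ} {u : Equiv.Perm (Fin (n + 1))} :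
    u ∈ weightStabilizer n i ↔ ∀ a, (u a).val < i ↔ a.val < i := by
  unfold weightStabilizer
  rw [MulAction.mem_stabilizer_set]
  rfl

/-- `w` is increasing on `{1, …, d}` and on `{d + 1, …, n + 1}`. -/
def IsBlockMono (n d : ℕ) (w : Equiv.Perm (Fin (n + 1))) : Prop :=
  ∀ a b : Fin (n + 1), a < b → (b.val < d ∨ d ≤ a.val) → w a < w b

/-- At a descent `p ≠ i`, the reflection lies in the stabilizer and would shorten `w`. -/
theorem IsMinCosetRep.isBlockMono {n i : ℕ} {w : Equiv.Perm (Fin (n + 1))}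
    (hw : IsMinCosetRep n i w) : IsBlockMono n i w := by
  have adj : ∀ p (hp : 1 ≤ p) (hpn : p ≤ n), p ≠ i →
      w ⟨p - 1, by omega⟩ < w ⟨p, by omega⟩ := by
    intro p hp hpn hpi
    by_contra h
    have hlt : w ⟨p, by omega⟩ < w ⟨p - 1, by omega⟩ := by
      refine lt_of_le_of_ne (not_lt.1 h) fun e => ?_
      have := w.injective e
      rw [Fin.mk.injEq] at this
      omega
    have h1 := card_inversions_mul_simpleReflection_lt hp hpn w hlt
    rw [← length_eq_card_inversions, ← length_eq_card_inversions] at h1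
    refine absurd (hw (simpleReflection n p) ?_) (not_le.2 h1)
    rw [mem_weightStabilizer]
    intro a
    rw [simpleReflection_val hp hpn]
    split_ifs <;> omega
  intro a b hab h
  obtain ⟨t, ht⟩ : ∃ t, b.val = a.val + 1 + t := ⟨b.val - a.val - 1, by
    rw [Fin.lt_def] at hab; omega⟩
  induction t generalizing b with
  | zero =>
    have := adj b.val (by omega) (by omega) (by omega)
    convert this using 2
    ext; simp only; omega
  | succ t ih =>
    have h1 := ih ⟨b.val - 1, by omega⟩ (by rw [Fin.lt_def]; simp only; omega)
      (by simp only; omega) (by simp only; omega)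
    exact h1.trans (adj b.val (by omega) (by omega) (by omega))

theorem minCosetRep_mem (n i : ℕ) (v : Equiv.Perm (Fin (n + 1))) :
    v⁻¹ * minCosetRep n i v ∈ weightStabilizer n i :=
  Function.argminOn_mem (length n) {x | v⁻¹ * x ∈ weightStabilizer n i} _

theorem isMinCosetRep_minCosetRep (n i : ℕ) (v : Equiv.Perm (Fin (n + 1))) :
    IsMinCosetRep n i (minCosetRep n i v) := by
  intro u hu
  refine Function.argminOn_le (length n) {x | v⁻¹ * x ∈ weightStabilizer n i} ?_
  change v⁻¹ * (minCosetRep n i v * u) ∈ weightStabilizer n i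
  rw [← mul_assoc]
  exact mul_mem (minCosetRep_mem n i v) hu

theorem wZero_isBlockMono (n i : ℕ) : IsBlockMono n i (wZero n i) :=
  (isMinCosetRep_minCosetRep n i _).isBlockMono

theorem wZero_lt_iff {n i : ℕ} (hin : i ≤ n) (a : Fin (n + 1)) :
    (wZero n i a).val < n + 1 - i ↔ i ≤ a.val := by
  have h := (mem_weightStabilizer.1 (minCosetRep_mem n i Fin.revPerm)) a
  change (Fin.rev (wZero n i a)).val < i ↔ a.val < i at h
  rw [Fin.val_rev] at h
  have := (wZero n i a).isLt
  omega

theorem IsBlockMono.add_le {n d : ℕ} {w : Equiv.Perm (Fin (n + 1))} (hw : IsBlockMono n d w)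
    (a b : Fin (n + 1)) (hab : a ≤ b) (h : b.val < d ∨ d ≤ a.val) :
    (w a).val + (b.val - a.val) ≤ (w b).val := by
  obtain ⟨t, ht⟩ : ∃ t, b.val = a.val + t := ⟨b.val - a.val, by
    rw [Fin.le_def] at hab; omega⟩
  induction t generalizing b with
  | zero =>
    have : a = b := Fin.ext ht.symm
    subst this
    simp
  | succ t ih =>
    have h1 := ih ⟨b.val - 1, by omega⟩ (by rw [Fin.le_def]; simp only; omega)
      (by simp only; omega) (by simp only; omega)
    have h2 := hw ⟨b.val - 1, by omega⟩ b (by rw [Fin.lt_def]; simp only; omega)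
      (by simp only; omega)
    rw [Fin.lt_def] at h2
    simp only at h1
    omega

/-- The last `n + 1 - i` points are mapped increasingly into the `n + 1 - i` smallest values, which
leaves no freedom. -/
theorem wZero_apply_of_le {n i : ℕ} (hin : i ≤ n) (a : Fin (n + 1)) (ha : i ≤ a.val) :
    (wZero n i a).val = a.val - i := by
  have h1 := (wZero_isBlockMono n i).add_le ⟨i, by omega⟩ a ha (Or.inr le_rfl)
  have h2 := (wZero_isBlockMono n i).add_le a (Fin.last n) (Fin.le_last a) (Or.inr ha)
  have h3 := (wZero_lt_iff hin (Fin.last n)).2 (by simpa using hin)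
  simp only [Fin.val_last] at h1 h2
  omega

theorem wZero_apply_inv (n i : ℕ) (b : Fin (n + 1)) : wZero n i ((wZero n i)⁻¹ b) = b :=
  Equiv.apply_symm_apply _ _

theorem wZero_inv_lt_iff {n i : ℕ} (hin : i ≤ n) (b : Fin (n + 1)) :
    i ≤ ((wZero n i)⁻¹ b).val ↔ b.val < n + 1 - i := by
  rw [← wZero_lt_iff hin, wZero_apply_inv]

/-- The inverse of `wZero` exchanges the two blocks and is increasing on each of them. -/
theorem mul_wZero_inv_isBlockMono {n i : ℕ} (hin : i ≤ n) {w : Equiv.Perm (Fin (n + 1))}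
    (hw : IsBlockMono n i w) : IsBlockMono n (n + 1 - i) (w * (wZero n i)⁻¹) := by
  intro b b' hb h
  rw [Equiv.Perm.mul_apply, Equiv.Perm.mul_apply]
  have h1 := wZero_inv_lt_iff hin b
  have h2 := wZero_inv_lt_iff hin b'
  rw [Fin.lt_def] at hb
  refine hw _ _ (lt_of_not_ge fun hle => ?_) (by omega)
  rcases hle.eq_or_lt with e | e
  · have := (wZero n i)⁻¹.injective e
    subst this
    omega
  · have h3 := wZero_isBlockMono n i _ _ e (by omega)
    simp only [wZero_apply_inv, Fin.lt_def] at h3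
    omega

theorem mul_wZero_inv_apply {n i : ℕ} (hin : i ≤ n) (w : Equiv.Perm (Fin (n + 1)))
    (a : Fin (n + 1)) (ha : i ≤ a.val) :
    (w * (wZero n i)⁻¹) ⟨a.val - i, by omega⟩ = w a := by
  rw [Equiv.Perm.mul_apply]
  congr 1
  rw [Equiv.Perm.inv_eq_iff_eq]
  exact Fin.ext (wZero_apply_of_le hin a ha).symm

/-- The number `w a` counts the smaller values: `a - i` of them come from the second block, the
others from an initial segment of the first block. The point `c` lies outside this segment exactly
when the segment has at most `c` elements. -/
theorem IsBlockMono.lt_iff {n i : ℕ} {w : Equiv.Perm (Fin (n + 1))} (hw : IsBlockMono n i w)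
    (hin : i ≤ n) (a c : Fin (n + 1)) (ha : i ≤ a.val) (hc : c.val < i) :
    w a < w c ↔ (w a).val ≤ a.val - i + c.val := by
  have mono : ∀ {x y : Fin (n + 1)}, x ≤ y → (y.val < i ∨ i ≤ x.val) → w x ≤ w y := by
    intro x y hxy h
    rcases hxy.eq_or_lt with rfl | h'
    · exact le_rfl
    · exact (hw x y h' h).le
  constructor
  · intro h
    have hdisj : Disjoint (Finset.Ico c ⟨i, by omega⟩) (Finset.Ioi a) := by
      rw [Finset.disjoint_left]
      intro x hx hx'
      simp only [Finset.mem_Ico, Finset.mem_Ioi, Fin.lt_def] at hx hx'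
      omega
    have hcard := Finset.card_le_card_of_injOn (s := Finset.Ico c ⟨i, by omega⟩ ∪ Finset.Ioi a)
      (t := Finset.Ioi (w a)) w ?_ w.injective.injOn
    · rw [Finset.card_union_of_disjoint hdisj, Fin.card_Ico, Fin.card_Ioi, Fin.card_Ioi] at hcard
      simp only at hcard
      omega
    · intro x hx
      simp only [Finset.coe_union, Set.mem_union, Finset.mem_coe, Finset.mem_Ico,
        Finset.mem_Ioi] at hx ⊢
      rcases hx with ⟨h1, h2⟩ | h1
      · exact h.trans_le (mono h1 (Or.inl h2))
      · exact hw a x h1 (Or.inr ha)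
  · intro h
    by_contra hlt
    have hca : w c < w a := by
      refine lt_of_le_of_ne (not_lt.1 hlt) fun e => ?_
      have := w.injective e
      subst this
      omega
    have hdisj : Disjoint (Finset.Iic c) (Finset.Ico ⟨i, by omega⟩ a) := by
      rw [Finset.disjoint_left]
      intro x hx hx'
      simp only [Finset.mem_Ico, Finset.mem_Iic, Fin.lt_def, Fin.le_def] at hx hx'
      omega
    have hcard := Finset.card_le_card_of_injOn (s := Finset.Iic c ∪ Finset.Ico ⟨i, by omega⟩ a)
      (t := Finset.Iio (w a)) w ?_ w.injective.injOn
    · rw [Finset.card_union_of_disjoint hdisj, Fin.card_Ico, Fin.card_Iic, Fin.card_Iio] at hcard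
      simp only at hcard
      omega
    · intro x hx
      simp only [Finset.coe_union, Set.mem_union, Finset.mem_coe, Finset.mem_Ico,
        Finset.mem_Iic, Finset.mem_Iio] at hx ⊢
      rcases hx with h1 | ⟨h1, h2⟩
      · exact (mono h1 (Or.inl hc)).trans_lt hca
      · exact hw x a h2 (Or.inr h1)

/-- Translates the shape of the poset into the values of `w * (wZero n i)⁻¹`. The set in `ell` is
closed downwards above `i`, because `w` is increasing on the second block, so its supremum decides
membership. -/
theorem le_ell_iff {n i : ℕ} (hi : 1 ≤ i) (hin : i ≤ n) {w : Equiv.Perm (Fin (n + 1))}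
    (hw : IsBlockMono n i w) {k j : ℕ} (hk : 1 ≤ k) (hki : k ≤ i) (hj : i ≤ j) :
    j ≤ ell n i w k ↔ ∃ h : j < n + 1,
      ((w * (wZero n i)⁻¹) ⟨j - i, by omega⟩).val < j - i + k := by
  have key : (∃ h : j < n + 1, ((w * (wZero n i)⁻¹) ⟨j - i, by omega⟩).val < j - i + k) ↔
      ∃ h : j < n + 1, w ⟨j, h⟩ < w ⟨k - 1, by omega⟩ := by
    refine exists_congr fun h => ?_
    have h1 := mul_wZero_inv_apply hin w ⟨j, h⟩ hj
    simp only at h1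
    rw [h1, hw.lt_iff hin _ _ hj (by simp only; omega)]
    simp only
    omega
  rw [key]
  unfold ell
  set S := {j | ∃ a c : Fin (n + 1), a.val = j ∧ c.val + 1 = k ∧ i ≤ j ∧ w a < w c} with hS
  have hbdd : BddAbove S := ⟨n, by rintro x ⟨a, c, rfl, -⟩; omega⟩
  constructor
  · intro h
    have hj' : j ≤ sSup S := by omega
    -- The supremum of the empty set is `0`, which is excluded by `1 ≤ i ≤ j`.
    have hne : S.Nonempty := by
      by_contra hne
      rw [Set.not_nonempty_iff_eq_empty] at hne
      rw [hne, csSup_empty, Nat.bot_eq_zero] at hj'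
      omega
    obtain ⟨a, c, h1, h2, h3, h4⟩ := Nat.sSup_mem hne hbdd
    refine ⟨by omega, ?_⟩
    have hc : c = ⟨k - 1, by omega⟩ := Fin.ext (by simp only; omega)
    rw [← hc]
    rcases hj'.eq_or_lt with e | e
    · have : (⟨j, by omega⟩ : Fin (n + 1)) = a := Fin.ext (by simp only; omega)
      rwa [this]
    · exact (hw _ a (by rw [Fin.lt_def]; simp only; omega) (Or.inr hj)).trans h4
  · rintro ⟨h, h'⟩
    exact le_max_of_le_right (le_csSup hbdd ⟨⟨j, h⟩, ⟨k - 1, by omega⟩, rfl,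
      by simp only; omega, hj, h'⟩)

/-! ### Gelfand-Tsetlin patterns -/

section Patterns

variable {n : ℕ} {c : ℕ → ℕ} {s : GTIndex n → ℝ}

theorem entry_succ_le (hs : s ∈ gtPolytope n c) {k j : ℕ} (hj : 1 ≤ j) (hkj : k + j ≤ n) :
    entry n c s (k + 1) j ≤ entry n c s k j :=
  (hs (k + 1) j (by omega) hj (by omega)).1

theorem entry_le_succ (hs : s ∈ gtPolytope n c) {k j : ℕ} (hj : 1 ≤ j) (hkj : k + j ≤ n) :
    entry n c s k (j + 1) ≤ entry n c s (k + 1) j :=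
  (hs (k + 1) j (by omega) hj (by omega)).2

/-- Entries grow along the antidiagonals towards the lower left. Together with the decrease down the
columns this makes every row decreasing. -/
theorem entry_le_diag (hs : s ∈ gtPolytope n c) {k j : ℕ} (t : ℕ) (hj : 1 ≤ j)
    (hkj : k + j + t ≤ n + 1) : entry n c s k (j + t) ≤ entry n c s (k + t) j := by
  induction t generalizing k with
  | zero => exact le_rfl
  | succ t ih =>
    have h1 := entry_le_succ hs (k := k) (j := j + t) (by omega) (by omega)
    have h2 := ih (k := k + 1) (by omega)
    rw [show k + 1 + t = k + (t + 1) by ring] at h2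
    exact h1.trans h2

theorem entry_anti_left (hs : s ∈ gtPolytope n c) {k k' j : ℕ} (hj : 1 ≤ j) (hk : k ≤ k')
    (hkj : k' + j ≤ n + 1) : entry n c s k' j ≤ entry n c s k j := by
  induction k', hk using Nat.le_induction with
  | base => exact le_rfl
  | succ k' hk ih => exact (entry_succ_le hs hj (by omega)).trans (ih (by omega))

theorem entry_anti_right (hs : s ∈ gtPolytope n c) {k j j' : ℕ} (hj : 1 ≤ j) (hjj : j ≤ j')
    (hkj : k + j' ≤ n + 1) : entry n c s k j' ≤ entry n c s k j := by
  obtain ⟨t, rfl⟩ := Nat.exists_eq_add_of_le hjj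
  exact (entry_le_diag hs t hj (by omega)).trans (entry_anti_left hs hj (by omega) (by omega))

end Patterns

/-! ### Patterns whose top row is a multiple of one fundamental weight -/

section Grassmannian

variable {n d m : ℕ} {s : GTIndex n → ℝ}

theorem topRow_single (hdn : d ≤ n) (j : ℕ) :
    topRow n (Pi.single d m) j = if j ≤ d then (m : ℝ) else 0 := by
  unfold topRow
  rw [Finset.sum_congr rfl (g := fun a => if d = a then (m : ℝ) else 0)
    (fun a _ => by
      rw [Pi.single_apply]
      by_cases h : a = d
      · rw [if_pos h, if_pos h.symm]
      · rw [if_neg h, if_neg (Ne.symm h), Nat.cast_zero]),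
    Finset.sum_ite_eq]
  simp [hdn]

theorem entry_zero (hdn : d ≤ n) (j : ℕ) :
    entry n (Pi.single d m) s 0 j = if j ≤ d then (m : ℝ) else 0 := by
  rw [← topRow_single hdn]
  simp [entry]

theorem entry_le (hdn : d ≤ n) (hs : s ∈ gtPolytope n (Pi.single d m)) {k j : ℕ} (hj : 1 ≤ j)
    (hkj : k + j ≤ n + 1) : entry n (Pi.single d m) s k j ≤ m := by
  refine (entry_anti_left hs hj (Nat.zero_le k) hkj).trans ?_
  rw [entry_zero hdn]
  split_ifs <;> simp

theorem entry_nonneg (hdn : d ≤ n) (hs : s ∈ gtPolytope n (Pi.single d m)) {k j : ℕ} (hj : 1 ≤ j)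
    (hkj : k + j ≤ n + 1) : 0 ≤ entry n (Pi.single d m) s k j := by
  have h := entry_le_diag hs (k := 0) k hj (by omega)
  rw [Nat.zero_add, entry_zero hdn] at h
  refine le_trans ?_ h
  split_ifs <;> simp

theorem entry_eq_zero (hdn : d ≤ n) (hs : s ∈ gtPolytope n (Pi.single d m)) {k j : ℕ} (hj : d < j)
    (hkj : k + j ≤ n + 1) : entry n (Pi.single d m) s k j = 0 := by
  refine le_antisymm ?_ (entry_nonneg hdn hs (by omega) hkj)
  refine (entry_anti_left hs (by omega) (Nat.zero_le k) hkj).trans ?_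
  rw [entry_zero hdn, if_neg (by omega)]

/-! ### Kogan faces of Grassmannian type -/

theorem upperProd_succ_apply (D : Finset (ℕ × ℕ)) (k : ℕ) (b : Fin (n + 1)) :
    ((upperProd n D (k + 1) b).val = (upperProd n D k b).val + 1 ∧
      k ≤ (upperProd n D k b).val ∧ (k, (upperProd n D k b).val + 1 - k) ∈ D) ∨
    (upperProd n D (k + 1) b).val ≤ (upperProd n D k b).val := by
  have h := wordProd_sorted_apply (koganRow n D k)
    (fun p hp => by rw [mem_koganRow] at hp; omega) (koganRow_pairwise n D k) (upperProd n D k b)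
  rw [mem_koganRow] at h
  rw [upperProd, Equiv.Perm.mul_apply]
  refine h.imp (fun h => ⟨h.1, by omega, h.2.2.2⟩) id

/-- Row `k` has only letters above `k`, which fix the positions below `k`; a point that falls behind
the row index is frozen for good. -/
theorem upperProd_succ_apply_of_lt (D : Finset (ℕ × ℕ)) {k : ℕ} {b : Fin (n + 1)}
    (h : (upperProd n D k b).val < k) : upperProd n D (k + 1) b = upperProd n D k b := by
  rw [upperProd, Equiv.Perm.mul_apply]
  refine wordProd_apply_of_lt _ (fun p hp => ?_) _ (fun p hp => ?_) <;>
    rw [mem_koganRow] at hp <;> omega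

theorem upperProd_apply_of_lt (D : Finset (ℕ × ℕ)) {k k' : ℕ} {b : Fin (n + 1)} (hk : k ≤ k')
    (h : (upperProd n D k b).val < k) : upperProd n D k' b = upperProd n D k b := by
  induction k', hk using Nat.le_induction with
  | base => rfl
  | succ k' hk ih => rw [upperProd_succ_apply_of_lt D (by rw [ih]; omega), ih]

/-- The entries of a pattern in a Kogan face along the trajectory of a point `b ≤ d`. -/
theorem entry_upperProd (hdn : d ≤ n) {D : Finset (ℕ × ℕ)}
    (hs : s ∈ koganFace n (Pi.single d m) D) {b : Fin (n + 1)} (hb : b.val < d) {k : ℕ}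
    (hk : k ≤ (upperProd n D k b).val) :
    entry n (Pi.single d m) s k ((upperProd n D k b).val + 1 - k) = m := by
  induction k with
  | zero =>
    rw [entry_zero hdn, if_pos]
    simpa [upperProd] using hb
  | succ k ih =>
    have hlt := (upperProd n D k b).isLt
    have hk' : k ≤ (upperProd n D k b).val := by
      by_contra h
      rw [upperProd_succ_apply_of_lt D (by omega)] at hk
      omega
    have ih := ih hk'
    rcases upperProd_succ_apply D k b with ⟨h1, h2, h3⟩ | h
    · rw [h1, show (upperProd n D k b).val + 1 + 1 - (k + 1) =
        (upperProd n D k b).val + 1 - k by omega, ← ih]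
      exact (hs.2 _ h3).symm
    · refine le_antisymm (entry_le hdn hs.1 (by omega) (by omega)) ?_
      have h1 := entry_le_succ hs.1 (k := k) (j := (upperProd n D k b).val - k) (by omega)
        (by omega)
      rw [show (upperProd n D k b).val - k + 1 = (upperProd n D k b).val + 1 - k by omega,
        ih] at h1
      exact h1.trans (entry_anti_right hs.1 (by omega) (by omega) (by omega))

theorem IsBlockMono.add_le_succ {τ : Equiv.Perm (Fin (n + 1))} (hτ : IsBlockMono n d τ)
    {j : ℕ} (hj : 1 ≤ j) (hjd : j ≤ d) (hdn : d ≤ n) :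
    (τ ⟨d - j, by omega⟩).val + j ≤ n + 1 := by
  have h := hτ.add_le ⟨d - j, by omega⟩ ⟨d - 1, by omega⟩ (by rw [Fin.le_def]; simp only; omega)
    (Or.inl (by simp only; omega))
  have := (τ ⟨d - 1, by omega⟩).isLt
  simp only at h
  omega

/-- In row `q = τ (d - j)` none of the `j` points from `d - j` to `d - 1` is frozen below `q`, since
their final values are at least `q`. Their positions are distinct, so one of them is at least `q + j
- 1`. The entry there is `m`, and it lies weakly right of place `j`. -/
theorem entry_eq_of_koganType (hdn : d ≤ n) {τ : Equiv.Perm (Fin (n + 1))}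
    (hτ : IsBlockMono n d τ) {D : Finset (ℕ × ℕ)} (hD : koganType n D = τ)
    (hs : s ∈ koganFace n (Pi.single d m) D) {j : ℕ} (hj : 1 ≤ j) (hjd : j ≤ d) :
    entry n (Pi.single d m) s (τ ⟨d - j, by omega⟩).val j = m := by
  have hbound := hτ.add_le_succ hj hjd hdn
  set q := (τ ⟨d - j, by omega⟩).val with hq
  have hpos : ∀ b : Fin (n + 1), d - j ≤ b.val → b.val < d → q ≤ (upperProd n D q b).val := by
    intro b hb hbd
    by_contra h
    have h1 := upperProd_apply_of_lt D (k' := n) (by omega) (not_le.1 h)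
    rw [← koganType_eq_upperProd, hD] at h1
    have h2 := hτ.add_le ⟨d - j, by omega⟩ b hb (Or.inl hbd)
    rw [h1] at h2
    omega
  obtain ⟨b, hb, hbd, hbj⟩ : ∃ b : Fin (n + 1), d - j ≤ b.val ∧ b.val < d ∧
      q + j ≤ (upperProd n D q b).val + 1 := by
    by_contra! hno
    have hcard := Finset.card_le_card_of_injOn
      (s := Finset.Ico (⟨d - j, by omega⟩ : Fin (n + 1)) ⟨d, by omega⟩)
      (t := Finset.Ico q (q + j - 1)) (fun b => (upperProd n D q b).val) ?_
      (fun x _ y _ h => (upperProd n D q).injective (Fin.ext h))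
    · rw [Fin.card_Ico, Nat.card_Ico] at hcard
      simp only at hcard
      omega
    · intro b hb
      simp only [Finset.mem_coe, Finset.mem_Ico, Fin.le_def, Fin.lt_def] at hb ⊢
      have h1 := hpos b hb.1 hb.2
      have h2 := hno b hb.1 hb.2
      omega
  have h1 := entry_upperProd hdn hs hbd (hpos b hb hbd)
  have hlt := (upperProd n D q b).isLt
  refine le_antisymm (entry_le hdn hs.1 hj (by omega)) ?_
  rw [← h1]
  exact entry_anti_right hs.1 hj (by omega) (by omega)

/-- For the converse, each equality of `codeSet τ` lies in the region that the conditions on the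
right force to be constantly `m`. -/
theorem mem_koganFace_codeSet_iff (hdn : d ≤ n) {τ : Equiv.Perm (Fin (n + 1))}
    (hτ : IsBlockMono n d τ) :
    s ∈ koganFace n (Pi.single d m) (codeSet τ) ↔ s ∈ gtPolytope n (Pi.single d m) ∧
      ∀ (j : ℕ), 1 ≤ j → ∀ (hjd : j ≤ d),
        entry n (Pi.single d m) s (τ ⟨d - j, by omega⟩).val j = m := by
  constructor
  · intro hs
    exact ⟨hs.1, fun j hj hjd => entry_eq_of_koganType hdn hτ (koganType_codeSet τ) hs hj hjd⟩
  · rintro ⟨hs, h⟩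
    refine ⟨hs, ?_⟩
    rintro ⟨k, j⟩ hkj
    rw [mem_codeSet] at hkj
    simp only
    -- Every point counted by `code τ k` is in the first block, as `τ` is increasing on the second.
    -- If no `c` existed, the counted points would lie strictly between `d - j` and `d` (below `d`
    -- if `j > d`), and there would be fewer than `j` of them.
    have key : ∃ c, ∃ hc : c ≤ d, j ≤ c ∧ k < (τ ⟨d - c, by omega⟩).val := by
      by_contra! hno
      have hlt : code τ k < j := by
        unfold code
        by_cases hjd : j ≤ d
        · have hcard := Finset.card_le_card (s := Finset.univ.filter fun b : Fin (n + 1) =>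
            k < (τ b).val ∧ ∃ a, (τ a).val = k ∧ b < a)
            (t := Finset.Ioo ⟨d - j, by omega⟩ ⟨d, by omega⟩) ?_
          · rw [Fin.card_Ioo] at hcard
            simp only at hcard
            omega
          · intro b hb
            simp only [Finset.mem_filter, Finset.mem_univ, true_and, Finset.mem_Ioo,
              Fin.lt_def] at hb ⊢
            obtain ⟨h1, a, h2, h3⟩ := hb
            have hbd : b.val < d := by
              by_contra hb
              have := hτ b a h3 (Or.inr (by omega))
              rw [Fin.lt_def] at this
              omega
            refine ⟨?_, hbd⟩
            by_contra hb
            have := hno (d - b.val) (by omega) (by omega)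
            have e : (⟨d - (d - b.val), by omega⟩ : Fin (n + 1)) = b :=
              Fin.ext (by simp only; omega)
            rw [e] at this
            omega
        · have hcard := Finset.card_le_card (s := Finset.univ.filter fun b : Fin (n + 1) =>
            k < (τ b).val ∧ ∃ a, (τ a).val = k ∧ b < a)
            (t := Finset.Iio ⟨d, by omega⟩) ?_
          · rw [Fin.card_Iio] at hcard
            simp only at hcard
            omega
          · intro b hb
            simp only [Finset.mem_filter, Finset.mem_univ, true_and, Finset.mem_Iio,
              Fin.lt_def] at hb ⊢
            obtain ⟨h1, a, h2, h3⟩ := hb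
            by_contra hb
            have := hτ b a h3 (Or.inr (by omega))
            rw [Fin.lt_def] at this
            omega
      omega
    obtain ⟨c, hc, hjc, hk⟩ := key
    have hbound := hτ.add_le_succ (j := c) (by omega) hc hdn
    have h1 := h c (by omega) hc
    have h2 : (m : ℝ) ≤ entry n (Pi.single d m) s (k + 1) j := by
      rw [← h1]
      exact (entry_anti_right hs hkj.1 hjc hbound).trans
        (entry_anti_left hs hkj.1 hk (by omega))
    have h3 := entry_le hdn hs (k := k) hkj.1 (by omega)
    have h4 := entry_succ_le hs (k := k) hkj.1 (by omega)
    exact le_antisymm (h3.trans h2) h4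

theorem koganFace_subset_codeSet (hdn : d ≤ n) {τ : Equiv.Perm (Fin (n + 1))}
    (hτ : IsBlockMono n d τ) {D : Finset (ℕ × ℕ)} (hD : koganType n D = τ) :
    koganFace n (Pi.single d m) D ⊆ koganFace n (Pi.single d m) (codeSet τ) :=
  fun _ hs => (mem_koganFace_codeSet_iff hdn hτ).2
    ⟨hs.1, fun _ hj hjd => entry_eq_of_koganType hdn hτ hD hs hj hjd⟩

end Grassmannian

/-! ### Unimodular isomorphisms -/

/-- Forgetting coordinates that are integral constants on `P` is a unimodular isomorphism. -/
theorem unimodularIso_of_comp {ι κ : Type} {φ : κ → ι} (hφ : Function.Injective φ) (z : ι → ℤ)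
    {P : Set (ι → ℝ)} {Q : Set (κ → ℝ)}
    (hP : ∀ s, s ∈ P ↔ (∀ p ∉ Set.range φ, s p = z p) ∧ s ∘ φ ∈ Q) : UnimodularIso P Q := by
  let f : (ι → ℝ) →ᵃ[ℝ] (κ → ℝ) := (LinearMap.funLeft ℝ ℝ φ).toAffineMap
  have hf : ∀ s, f s = s ∘ φ := fun s => rfl
  have hspan : ∀ s ∈ affineSpan ℝ P, ∀ p ∉ Set.range φ, s p = z p := by
    intro s hs p hp
    refine affineSpan_induction (p := fun s : ι → ℝ => s p = z p) hs
      (fun s hs => ((hP s).1 hs).1 p hp) fun c u v w hu hv hw => ?_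
    simp [hu, hv, hw]
  have himage : f '' P = Q := by
    ext x
    constructor
    · rintro ⟨s, hs, rfl⟩
      exact ((hP s).1 hs).2
    · intro hx
      have hext : Function.extend φ x (fun p => (z p : ℝ)) ∘ φ = x := by
        ext q
        exact hφ.extend_apply _ _ _
      refine ⟨Function.extend φ x (fun p => (z p : ℝ)), (hP _).2 ⟨fun p hp => ?_, ?_⟩, hext⟩
      · exact Function.extend_apply' _ _ _ hp
      · rwa [hext]
  refine ⟨f, ?_, himage, ?_⟩
  · intro s hs t ht hst
    ext p
    by_cases hp : p ∈ Set.range φ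
    · obtain ⟨q, rfl⟩ := hp
      exact congrFun hst q
    · rw [hspan s hs p hp, hspan t ht p hp]
  · have hmap := AffineSubspace.map_span f P
    rw [himage] at hmap
    ext x
    rw [← hmap]
    constructor
    · rintro ⟨s, ⟨hs, hz⟩, rfl⟩
      exact ⟨⟨s, hs, rfl⟩, fun q => hz (φ q)⟩
    · rintro ⟨⟨s, hs, rfl⟩, hz⟩
      refine ⟨s, ⟨hs, fun p => ?_⟩, rfl⟩
      -- An integral image lifts to an integral point, because the forgotten coordinates are the
      -- integers `z p` on the whole affine hull.
      by_cases hp : p ∈ Set.range φ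
      · obtain ⟨q, rfl⟩ := hp
        exact hz q
      · exact ⟨z p, hspan s hs p hp⟩

theorem mem_smul_orderPolytope {P : Type} [PartialOrder P] (m : ℕ) (x : P → ℝ) :
    x ∈ (m : ℝ) • orderPolytope P ↔
      (∀ a, 0 ≤ x a ∧ x a ≤ m) ∧ ∀ a b, b < a → x b ≤ x a := by
  rw [Set.mem_smul_set]
  constructor
  · rintro ⟨y, ⟨h1, h2⟩, rfl⟩
    have hm : (0 : ℝ) ≤ m := Nat.cast_nonneg m
    refine ⟨fun a => ⟨mul_nonneg hm (h1 a).1, mul_le_of_le_one_right hm (h1 a).2⟩,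
      fun a b hab => mul_le_mul_of_nonneg_left (h2 a b hab) hm⟩
  · rintro ⟨h1, h2⟩
    -- For `m = 0` no rescaling is possible; both sides then reduce to the origin.
    rcases Nat.eq_zero_or_pos m with rfl | hm
    · refine ⟨0, ⟨fun a => by simp, fun a b _ => le_rfl⟩, ?_⟩
      ext a
      have := h1 a
      rw [Nat.cast_zero] at this
      rw [smul_zero]
      exact this.1.antisymm this.2
    · have hm' : (0 : ℝ) < m := Nat.cast_pos.2 hm
      refine ⟨(m : ℝ)⁻¹ • x, ⟨fun a => ⟨?_, ?_⟩, fun a b hab => ?_⟩, smul_inv_smul₀ hm'.ne' x⟩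
      · exact mul_nonneg (inv_nonneg.2 hm'.le) (h1 a).1
      · rw [Pi.smul_apply, smul_eq_mul, inv_mul_le_one₀ hm']
        exact (h1 a).2
      · exact mul_le_mul_of_nonneg_left (h2 a b hab) (inv_nonneg.2 hm'.le)

/-! ### The face and the order polytope -/

section Coordinates

variable {n i : ℕ}

theorem ellPoset_bounds (hi : 1 ≤ i) (hin : i ≤ n) {w : Equiv.Perm (Fin (n + 1))}
    (hw : IsBlockMono n i w) (q : EllPoset i (ell n i w)) :
    1 ≤ OrderDual.ofDual q.1.1 ∧ OrderDual.ofDual q.1.1 ≤ i ∧ i ≤ q.1.2 ∧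
      ∃ h : q.1.2 < n + 1, ((w * (wZero n i)⁻¹) ⟨q.1.2 - i, by omega⟩).val <
        q.1.2 - i + OrderDual.ofDual q.1.1 :=
  ⟨q.2.1.1, q.2.1.2, q.2.2.1,
    (le_ell_iff hi hin hw q.2.1.1 q.2.1.2 q.2.2.1).1 q.2.2.2⟩

/-- The coordinate of the Gelfand-Tsetlin polytope that corresponds to `x_{k,j}`. -/
def gtCoord (hi : 1 ≤ i) (hin : i ≤ n) {w : Equiv.Perm (Fin (n + 1))}
    (hw : IsBlockMono n i w) (q : EllPoset i (ell n i w)) : GTIndex n :=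
  ⟨(q.1.2 - i + OrderDual.ofDual q.1.1, n + 1 - q.1.2), by
    obtain ⟨h1, h2, h3, h4, -⟩ := ellPoset_bounds hi hin hw q
    simp only
    omega⟩

theorem gtCoord_injective (hi : 1 ≤ i) (hin : i ≤ n) {w : Equiv.Perm (Fin (n + 1))}
    (hw : IsBlockMono n i w) : Function.Injective (gtCoord hi hin hw) := by
  intro q q' h
  obtain ⟨h1, h2, h3, h4, -⟩ := ellPoset_bounds hi hin hw q
  obtain ⟨h1', h2', h3', h4', -⟩ := ellPoset_bounds hi hin hw q'
  simp only [gtCoord, Subtype.mk.injEq, Prod.mk.injEq] at h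
  refine Subtype.ext (Prod.ext (OrderDual.ofDual.injective ?_) ?_) <;> omega

theorem exists_gtCoord_eq (hi : 1 ≤ i) (hin : i ≤ n) {w : Equiv.Perm (Fin (n + 1))}
    (hw : IsBlockMono n i w) {k j : ℕ} (hj : 1 ≤ j) (hjd : j ≤ n + 1 - i) (hkj : k + j ≤ n + 1)
    (h : ((w * (wZero n i)⁻¹) ⟨n + 1 - i - j, by omega⟩).val < k) :
    ∃ q : EllPoset i (ell n i w), OrderDual.ofDual q.1.1 = k - (n + 1 - i - j) ∧
      q.1.2 = n + 1 - j := by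
  -- This gives `n + 1 - i - j < k`, so that the first poset index is at least `1`.
  have h1 := (mul_wZero_inv_isBlockMono hin hw).add_le 0 ⟨n + 1 - i - j, by omega⟩
    (Fin.zero_le _) (Or.inl (by simp only; omega))
  simp only [Fin.val_zero] at h1
  refine ⟨⟨(OrderDual.toDual (k - (n + 1 - i - j)), n + 1 - j), ⟨?_, ?_⟩, ?_, ?_⟩, rfl, rfl⟩
  · simp only [OrderDual.ofDual_toDual]; omega
  · simp only [OrderDual.ofDual_toDual]; omega
  · simp only; omega
  · simp only [OrderDual.ofDual_toDual]
    rw [le_ell_iff hi hin hw (by omega) (by omega) (by omega)]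
    refine ⟨by omega, ?_⟩
    have e : n + 1 - j - i = n + 1 - i - j := by omega
    simp only [e]
    omega

theorem entry_gtCoord (hi : 1 ≤ i) (hin : i ≤ n) {w : Equiv.Perm (Fin (n + 1))}
    (hw : IsBlockMono n i w) (c : ℕ → ℕ) (s : GTIndex n → ℝ) (q : EllPoset i (ell n i w)) :
    s (gtCoord hi hin hw q) =
      entry n c s (q.1.2 - i + OrderDual.ofDual q.1.1) (n + 1 - q.1.2) := by
  have h := (gtCoord hi hin hw q).2
  simp only [gtCoord] at h
  unfold entry
  rw [if_neg (by omega), dif_pos h]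
  rfl

/-- The triangle splits into a region of zeros, a region of entries `m`, and the free entries given
by `gtCoord`. Interlacing between free entries is an order relation of the poset; an inequality that
involves a fixed entry follows from the bounds `0` and `m`. -/
theorem mem_koganFace_iff_comp_gtCoord (hi : 1 ≤ i) (hin : i ≤ n)
    {w : Equiv.Perm (Fin (n + 1))} (hw : IsBlockMono n i w) (m : ℕ) (s : GTIndex n → ℝ) :
    s ∈ koganFace n (Pi.single (n + 1 - i) m) (codeSet (w * (wZero n i)⁻¹)) ↔
      (∀ p ∉ Set.range (gtCoord hi hin hw),
        s p = ((if p.1.2 ≤ n + 1 - i then (m : ℤ) else 0 : ℤ) : ℝ)) ∧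
      s ∘ gtCoord hi hin hw ∈ (m : ℝ) • orderPolytope (EllPoset i (ell n i w)) := by
  have hτ := mul_wZero_inv_isBlockMono hin hw
  have hdn : n + 1 - i ≤ n := by omega
  rw [mem_koganFace_codeSet_iff hdn hτ, mem_smul_orderPolytope]
  set e := entry n (Pi.single (n + 1 - i) m) s with he
  have hcoord : ∀ q, (s ∘ gtCoord hi hin hw) q =
      e (q.1.2 - i + OrderDual.ofDual q.1.1) (n + 1 - q.1.2) := fun q =>
    entry_gtCoord hi hin hw _ s q
  have hentry : ∀ p : GTIndex n, s p = e p.1.1 p.1.2 := by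
    rintro ⟨⟨k, j⟩, hp⟩
    simp only at hp
    simp only [he, entry]
    rw [if_neg (by omega), dif_pos hp]
  constructor
  · rintro ⟨hs, hm⟩
    refine ⟨fun p hp => ?_, fun q => ?_, fun a b hab => ?_⟩
    · rw [hentry]
      obtain ⟨⟨k, j⟩, h⟩ := p
      simp only at h
      simp only
      split_ifs with hj
      · have hk : k ≤ ((w * (wZero n i)⁻¹) ⟨n + 1 - i - j, by omega⟩).val := by
          by_contra hk
          obtain ⟨q, h1, h2⟩ := exists_gtCoord_eq hi hin hw h.2.1 hj h.2.2 (not_le.1 hk)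
          obtain ⟨b1, b2, b3, b4, -⟩ := ellPoset_bounds hi hin hw q
          refine hp ⟨q, ?_⟩
          simp only [gtCoord, Subtype.mk.injEq, Prod.mk.injEq]
          omega
        have hb := hτ.add_le_succ h.2.1 hj hdn
        have h1 := entry_anti_left hs h.2.1 hk hb
        rw [← he, hm j h.2.1 hj] at h1
        push_cast
        exact (entry_le hdn hs h.2.1 h.2.2).antisymm h1
      · push_cast
        exact entry_eq_zero hdn hs (by omega) h.2.2
    · obtain ⟨b1, b2, b3, b4, -⟩ := ellPoset_bounds hi hin hw q
      rw [hcoord]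
      exact ⟨entry_nonneg hdn hs (by omega) (by omega), entry_le hdn hs (by omega) (by omega)⟩
    · rw [hcoord, hcoord]
      obtain ⟨a1, a2, a3, a4, -⟩ := ellPoset_bounds hi hin hw a
      obtain ⟨b1, b2, b3, b4, -⟩ := ellPoset_bounds hi hin hw b
      have h1 : OrderDual.ofDual a.1.1 ≤ OrderDual.ofDual b.1.1 := hab.le.1
      have h2 : b.1.2 ≤ a.1.2 := hab.le.2
      have h3 := entry_le_diag hs (k := b.1.2 - i + OrderDual.ofDual b.1.1)
        (j := n + 1 - a.1.2) (a.1.2 - b.1.2) (by omega) (by omega)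
      rw [show n + 1 - a.1.2 + (a.1.2 - b.1.2) = n + 1 - b.1.2 by omega] at h3
      exact h3.trans (entry_anti_left hs (by omega) (by omega) (by omega))
  · rintro ⟨hconst, hbd, hord⟩
    have hzero : ∀ k j, n + 1 - i < j → k + j ≤ n + 1 → e k j = 0 := by
      intro k j hj hkj
      rcases Nat.eq_zero_or_pos k with rfl | hk
      · rw [he, entry_zero hdn, if_neg (by omega)]
      · have h := hconst ⟨(k, j), hk, by simp only; omega, hkj⟩ ?_
        · rw [hentry] at h
          simp only at h
          rw [h, if_neg (by omega), Int.cast_zero]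
        · rintro ⟨q, hq⟩
          obtain ⟨b1, b2, b3, b4, -⟩ := ellPoset_bounds hi hin hw q
          simp only [gtCoord, Subtype.mk.injEq, Prod.mk.injEq] at hq
          omega
    have hmax : ∀ k j, 1 ≤ j → ∀ (hj : j ≤ n + 1 - i), k + j ≤ n + 1 →
        k ≤ ((w * (wZero n i)⁻¹) ⟨n + 1 - i - j, by omega⟩).val → e k j = m := by
      intro k j hj hjd hkj hk
      rcases Nat.eq_zero_or_pos k with rfl | hk0
      · rw [he, entry_zero hdn, if_pos hjd]
      · have h := hconst ⟨(k, j), hk0, hj, hkj⟩ ?_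
        · rw [hentry] at h
          simp only at h
          rw [h, if_pos hjd, Int.cast_natCast]
        · rintro ⟨q, hq⟩
          obtain ⟨h1, h2, h3, h4, h5⟩ := ellPoset_bounds hi hin hw q
          simp only [gtCoord, Subtype.mk.injEq, Prod.mk.injEq] at hq
          have e1 : n + 1 - i - j = q.1.2 - i := by omega
          simp only [e1] at hk
          omega
    have hbounds : ∀ k j, 1 ≤ j → k + j ≤ n + 1 → 0 ≤ e k j ∧ e k j ≤ m := by
      intro k j hj hkj
      by_cases hjd : j ≤ n + 1 - i
      · by_cases hk : k ≤ ((w * (wZero n i)⁻¹) ⟨n + 1 - i - j, by omega⟩).val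
        · rw [hmax k j hj hjd hkj hk]
          exact ⟨Nat.cast_nonneg m, le_rfl⟩
        · obtain ⟨q, h1, h2⟩ := exists_gtCoord_eq hi hin hw hj hjd hkj (not_le.1 hk)
          obtain ⟨h3, h4, h5, h6, -⟩ := ellPoset_bounds hi hin hw q
          have h := hbd q
          rw [hcoord, show q.1.2 - i + OrderDual.ofDual q.1.1 = k by omega,
            show n + 1 - q.1.2 = j by omega] at h
          exact h
      · rw [hzero k j (by omega) hkj]
        exact ⟨le_rfl, Nat.cast_nonneg m⟩
    -- The entry `(k, j)` corresponds to the poset element with indices `k + j - (n + 1 - i)` and `n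
    -- + 1 - j`, so the inequalities assumed here are the order relation of the poset.
    have hfree : ∀ k j k' j', 1 ≤ j → j ≤ j' → k + j ≤ k' + j' → (k, j) ≠ (k', j') →
        ∀ (hj' : j' ≤ n + 1 - i), k + j ≤ n + 1 → k' + j' ≤ n + 1 →
        (∀ h : n + 1 - i - j < n + 1, ((w * (wZero n i)⁻¹) ⟨n + 1 - i - j, h⟩).val < k) →
        (∀ h : n + 1 - i - j' < n + 1, ((w * (wZero n i)⁻¹) ⟨n + 1 - i - j', h⟩).val < k') →
        e k' j' ≤ e k j := by
      intro k j k' j' hj hjj hkj hne hj' h1 h2 h3 h4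
      obtain ⟨q, hq1, hq2⟩ := exists_gtCoord_eq hi hin hw hj (by omega) h1 (h3 (by omega))
      obtain ⟨q', hq1', hq2'⟩ :=
        exists_gtCoord_eq hi hin hw (by omega) hj' h2 (h4 (by omega))
      obtain ⟨b1, b2, b3, b4, -⟩ := ellPoset_bounds hi hin hw q
      obtain ⟨b1', b2', b3', b4', -⟩ := ellPoset_bounds hi hin hw q'
      have hle : q' ≤ q := by
        refine ⟨?_, ?_⟩
        · change OrderDual.ofDual q.1.1 ≤ OrderDual.ofDual q'.1.1
          omega
        · omega
      have hlt : q' < q := by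
        refine lt_of_le_of_ne hle fun h => hne ?_
        subst h
        rw [Prod.mk.injEq]
        omega
      have h := hord q q' hlt
      rw [hcoord, hcoord, show q.1.2 - i + OrderDual.ofDual q.1.1 = k by omega,
        show n + 1 - q.1.2 = j by omega, show q'.1.2 - i + OrderDual.ofDual q'.1.1 = k' by omega,
        show n + 1 - q'.1.2 = j' by omega] at h
      exact h
    refine ⟨?_, fun j hj hjd => hmax _ _ hj hjd (hτ.add_le_succ hj hjd hdn) le_rfl⟩
    rintro k j hk hj hkj
    obtain ⟨k, rfl⟩ := Nat.exists_eq_add_of_le' hk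
    rw [Nat.add_sub_cancel]
    constructor
    · by_cases hjd : j ≤ n + 1 - i
      · by_cases h : k ≤ ((w * (wZero n i)⁻¹) ⟨n + 1 - i - j, by omega⟩).val
        · have := hmax k j hj hjd (by omega) h
          rw [← he, this]
          exact (hbounds (k + 1) j hj hkj).2
        · exact hfree k j (k + 1) j hj le_rfl (by omega) (by simp) hjd (by omega) hkj
            (fun _ => not_le.1 h) (fun _ => by omega)
      · rw [← he, hzero k j (by omega) (by omega), hzero (k + 1) j (by omega) hkj]
    · by_cases hjd : j + 1 ≤ n + 1 - i
      · by_cases h : k + 1 ≤ ((w * (wZero n i)⁻¹) ⟨n + 1 - i - j, by omega⟩).val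
        · have := hmax (k + 1) j hj (by omega) hkj h
          rw [← he, this]
          exact (hbounds k (j + 1) (by omega) (by omega)).2
        -- As `τ` increases on the first block, a free entry `(k + 1, j)` forces its upper right
        -- neighbour `(k, j + 1)` to be free as well.
        · have h1 := hτ ⟨n + 1 - i - (j + 1), by omega⟩ ⟨n + 1 - i - j, by omega⟩
            (by rw [Fin.lt_def]; simp only; omega) (Or.inl (by simp only; omega))
          rw [Fin.lt_def] at h1
          exact hfree (k + 1) j k (j + 1) hj (by omega) (by omega) (by simp) hjd hkj (by omega)
            (fun _ => not_le.1 h) (fun _ => by omega)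
      · rw [← he, hzero k (j + 1) (by omega) (by omega)]
        exact (hbounds (k + 1) j hj hkj).1

end Coordinates

end KoganFaces

end

open KoganFaces in
theorem mainTheorem3 (n i : ℕ) (hi : 1 ≤ i) (hin : i ≤ n)
    (w : Equiv.Perm (Fin (n + 1))) (hw : IsMinCosetRep n i w) :
    ∃ D : Finset (ℕ × ℕ), (D : Set (ℕ × ℕ)) ⊆ koganIndex n ∧
      koganType n D = w * (wZero n i)⁻¹ ∧ IsReducedKogan n D ∧
      ∀ m : ℕ,
        (∀ F, Maximal (IsKoganFace n (Pi.single (n + 1 - i) m) (w * (wZero n i)⁻¹)) F ↔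
          F = koganFace n (Pi.single (n + 1 - i) m) D) ∧
        (∀ F, IsKoganFace n (Pi.single (n + 1 - i) m) (w * (wZero n i)⁻¹) F →
          F ⊆ koganFace n (Pi.single (n + 1 - i) m) D) ∧
        UnimodularIso (koganFace n (Pi.single (n + 1 - i) m) D)
          ((m : ℝ) • orderPolytope (EllPoset i (ell n i w))) := by
  have hmono := hw.isBlockMono
  refine ⟨codeSet (w * (wZero n i)⁻¹), codeSet_subset _, koganType_codeSet _,
    isReducedKogan_codeSet _, fun m => ?_⟩
  have hface : IsKoganFace n (Pi.single (n + 1 - i) m) (w * (wZero n i)⁻¹)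
      (koganFace n (Pi.single (n + 1 - i) m) (codeSet (w * (wZero n i)⁻¹))) :=
    ⟨_, codeSet_subset _, koganType_codeSet _, rfl⟩
  have hsub : ∀ F, IsKoganFace n (Pi.single (n + 1 - i) m) (w * (wZero n i)⁻¹) F →
      F ⊆ koganFace n (Pi.single (n + 1 - i) m) (codeSet (w * (wZero n i)⁻¹)) := by
    rintro F ⟨D, -, hD, rfl⟩
    exact koganFace_subset_codeSet (by omega) (mul_wZero_inv_isBlockMono hin hmono) hD
  refine ⟨fun F => ⟨fun hF => ?_, ?_⟩, hsub, ?_⟩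
  · exact (hsub F hF.1).antisymm (hF.2 hface (hsub F hF.1))
  · rintro rfl
    exact ⟨hface, fun F hF _ => hsub F hF⟩
  · exact unimodularIso_of_comp (gtCoord_injective hi hin hmono) _
      (mem_koganFace_iff_comp_gtCoord hi hin hmono m)
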